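/- Let $F_2$ be the free group on two generators $a,b$, and write $A=a^{-1}$, $B=b^{-1}$, $[x,y]=xyx^{-1}y^{-1}$. For an element $g$ of the commutator subgroup $[G,G]$ of a group $G$, the commutator length $\mathrm{cl}(g)$ is the least number of commutators in $G$ whose product is $g$, and the stable commutator length is $\mathrm{scl}(g)=\lim_{n\to\infty}\mathrm{cl}(g^n)/n$. Let $$w=ababABaBAbAB,\qquad v=baBABAbaBabA .$$ Then $w\in[F_2,F_2]$ and $$\mathrm{scl}(w)=\tfrac56 .$$ In particular $\mathrm{scl}(w)\notin\frac12\mathbb Z$, so it is not true that $\mathrm{scl}(g)\in\frac12\mathbb Z$ for every $g\in[F_2,F_2]$; this answers Bavard's question in the negative. Moreover, $v$ is conjugate to $w^{-1}$ in $F_2$, and the conjugate $a v^3 A$ of $w^{-3}$ is a product of three commutators: $$[abaB,\;ABAbaBabAbaBABAbaBababABB]\cdot[ABAba,\;BabAbaBABAbba]\cdot[BabABababA,\;aaBAAb]=a\,v^3A .$$ -/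

import Mathlib

open Filter Topology
open scoped ENNReal commutatorElement

/-- The commutator length of `g`: the least `n` such that `g` is a product of `n` commutators,
and `⊤` if there is no such `n`, that is, if `g` is not in the commutator subgroup. -/
noncomputable def commutatorLength {G : Type*} [Group G] (g : G) : ℕ∞ :=
  ⨅ (l : List G) (_ : (∀ x ∈ l, x ∈ commutatorSet G) ∧ l.prod = g), (l.length : ℕ∞)

/-- The stable commutator length of `g`: the lower limit of `cl (g ^ n) / n` as `n → ∞`
(which is a limit if `g` is in the commutator subgroup). -/
noncomputable def scl {G : Type*} [Group G] (g : G) : ℝ≥0∞ :=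
  liminf (fun n : ℕ => (commutatorLength (g ^ n) : ℝ≥0∞) / (n : ℝ≥0∞)) atTop

/-- The free group of rank two. -/
abbrev F₂ : Type := FreeGroup (Fin 2)

namespace F₂

/-- The first free generator. -/
abbrev a : F₂ := FreeGroup.of 0

/-- The second free generator. -/
abbrev b : F₂ := FreeGroup.of 1

/-- The inverse of `a`. -/
abbrev A : F₂ := a⁻¹

/-- The inverse of `b`. -/
abbrev B : F₂ := b⁻¹

/-- The word `ababABaBAbAB`. -/
def w : F₂ := a * b * a * b * A * B * a * B * A * b * A * B

/-- The word `baBABAbaBabA`. -/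
def v : F₂ := b * a * B * A * B * A * b * a * B * a * b * A

end F₂

/-! Lower bound, in the spirit of Bavard duality: `quasi` is an antisymmetrized count of subwords
with `quasi (g * h) ≤ quasi g + quasi h + 3`. A commutator costs four such steps, so a product of
`m` commutators has value at most `12 * m`, while each period of `w` contributes `10`; hence cl(w^n)
is at least about 10n/12 = 5n/6. The defect `3` is local: the words of g, h and gh form a tripod,
all but its centre cancels, and `corner_check` goes through the finitely many centres. Upper bound:
w⁻³ is conjugate to a product of three commutators. In its k-th power two of them cost 2k, and the
third costs only k/2 + 1 by `commutatorElement_pow`. So 3k periods of `w` cost 5k/2 up to a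
constant, again 5/6 each. -/

namespace F₂

/-! ### Weighted subword counts and the finite check at a tripod. -/

/-- The weight of the occurrences of counted words starting at the first letter of a word:
`ab`, `ba`, `aba`, `bab`, `aBAb` and `baba` have weights `1`, `-3`, `2`, `2`, `2` and `-2`. -/
def prefixWeight : List (Fin 2 × Bool) → ℤ
  | (0, true) :: (1, true) :: (0, true) :: _ => 3
  | (0, true) :: (1, true) :: _ => 1
  | (0, true) :: (1, false) :: (0, false) :: (1, true) :: _ => 2
  | (1, true) :: (0, true) :: (1, true) :: (0, true) :: _ => -3
  | (1, true) :: (0, true) :: (1, true) :: _ => -1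
  | (1, true) :: (0, true) :: _ => -3
  | _ => 0

/-- The weighted count of subwords. -/
def weightedCount : List (Fin 2 × Bool) → ℤ
  | [] => 0
  | x :: l => prefixWeight ((x :: l).take 4) + weightedCount l

/-- The weighted count of the subwords of `l ++ q` that cross the junction. -/
def junction (l q : List (Fin 2 × Bool)) : ℤ :=
  weightedCount (l ++ q) - weightedCount l - weightedCount q

theorem junction_nil (q : List (Fin 2 × Bool)) : junction [] q = 0 := by
  simp [junction, weightedCount]

theorem junction_cons (c : Fin 2 × Bool) (l q : List (Fin 2 × Bool)) :
    junction (c :: l) q =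
      prefixWeight ((c :: (l ++ q)).take 4) - prefixWeight ((c :: l).take 4) + junction l q := by
  simp only [junction, weightedCount, List.cons_append]
  ring

theorem junction_take_right (l q : List (Fin 2 × Bool)) :
    junction l (q.take 3) = junction l q := by
  induction l with
  | nil => simp [junction_nil]
  | cons c l ih =>
    rw [junction_cons, junction_cons, ih]
    have : (c :: (l ++ q.take 3)).take 4 = (c :: (l ++ q)).take 4 := by
      simp [List.take_append, List.take_take]
    rw [this]

theorem junction_append_left (m l q : List (Fin 2 × Bool)) (hl : 3 ≤ l.length) :
    junction (m ++ l) q = junction l q := by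
  induction m with
  | nil => rfl
  | cons c m ih =>
    have : (c :: (m ++ l ++ q)).take 4 = (c :: (m ++ l)).take 4 := by
      rw [List.take_succ_cons, List.take_succ_cons, List.take_append_of_le_length]
      simp; omega
    rw [List.cons_append, junction_cons, ih, this]
    ring

open FreeGroup in
-- Counted words have at most four letters, so one crossing a junction sees at most three on either
-- side.
theorem junction_invRev_take (p q : List (Fin 2 × Bool)) :
    junction (invRev (p.take 3)) (q.take 3) = junction (invRev p) q := by
  rw [junction_take_right]
  rcases le_or_gt p.length 3 with h | h
  · rw [List.take_of_length_le h]
  · conv_rhs => rw [← List.take_append_drop 3 p, invRev_append]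
    rw [junction_append_left]
    simp; omega

/-- Two words do not start with the same letter. -/
def HeadNe (p q : List (Fin 2 × Bool)) : Prop := ∀ c ∈ p.head?, c ∉ q.head?

/-- A decidable form of `HeadNe`. -/
def headNe : List (Fin 2 × Bool) → List (Fin 2 × Bool) → Bool
  | x :: _, y :: _ => !(x == y)
  | _, _ => true

theorem HeadNe.headNe_take {p q : List (Fin 2 × Bool)} (h : HeadNe p q) :
    headNe (p.take 3) (q.take 3) = true := by
  cases p <;> cases q <;> simp_all [HeadNe, headNe]
  exact fun h' => h h'.symm

/-- The four letters. -/
def letters : List (Fin 2 × Bool) := [(0, true), (1, true), (0, false), (1, false)]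

/-- The words of length at most three. -/
def shortWords : List (List (Fin 2 × Bool)) :=
  [] :: (letters.flatMap fun x => [x] :: letters.flatMap fun y =>
    [x, y] :: letters.map fun z => [x, y, z])

theorem mem_letters (x : Fin 2 × Bool) : x ∈ letters := by
  revert x; decide

theorem take_mem_shortWords (p : List (Fin 2 × Bool)) : p.take 3 ∈ shortWords := by
  rcases p with _ | ⟨x, _ | ⟨y, _ | ⟨z, p⟩⟩⟩ <;>
    simp [shortWords, mem_letters]

/-- The initial part of a word that matters for the junctions at its beginning. -/
def trunc : List (Fin 2 × Bool) → List (Fin 2 × Bool)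
  | (0, true) :: (1, true) :: (0, true) :: _ => [(0, true), (1, true), (0, true)]
  | (0, true) :: (1, true) :: (0, false) :: _ => [(0, true), (1, true), (0, false)]
  | (0, true) :: (1, true) :: _ => [(0, true), (1, true)]
  | (1, false) :: (0, false) :: (1, true) :: _ => [(1, false), (0, false), (1, true)]
  | (1, false) :: (0, false) :: (1, false) :: _ => [(1, false), (0, false), (1, false)]
  | (1, false) :: (0, false) :: _ => [(1, false), (0, false)]
  | (1, true) :: (0, true) :: _ => [(1, true), (0, true)]
  | (1, true) :: (0, false) :: _ => [(1, true), (0, false)]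
  | (0, false) :: (1, true) :: _ => [(0, false), (1, true)]
  | (0, false) :: (1, false) :: _ => [(0, false), (1, false)]
  | x :: _ => [x]
  | [] => []

/-- The images of `trunc`. -/
def truncWords : List (List (Fin 2 × Bool)) :=
  [[], [(0, true)], [(0, true), (1, true)], [(0, true), (1, true), (0, true)],
    [(0, true), (1, true), (0, false)], [(1, true)], [(1, true), (0, true)],
    [(1, true), (0, false)], [(0, false)], [(0, false), (1, true)], [(0, false), (1, false)],
    [(1, false)], [(1, false), (0, false)], [(1, false), (0, false), (1, true)],
    [(1, false), (0, false), (1, false)]]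

open FreeGroup

/-- The antisymmetrized weighted count at the corner between the words `p` and `q`. -/
def corner (p q : List (Fin 2 × Bool)) : ℤ :=
  junction (invRev p) q - junction (invRev q) p

theorem corner_take (p q : List (Fin 2 × Bool)) : corner (p.take 3) (q.take 3) = corner p q := by
  simp only [corner, junction_invRev_take]

/-- This cuts the 85 short words to 15, so that `corner_check` runs over 15³ triples. -/
theorem trunc_check : (shortWords.all fun p => truncWords.contains (trunc p) && shortWords.all fun q =>
    headNe (trunc p) (trunc q) == headNe p q &&
    (!headNe p q || corner p q == corner (trunc p) (trunc q))) = true := by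
  decide +kernel

theorem corner_check : (truncWords.all fun p => truncWords.all fun q => !headNe p q ||
    truncWords.all fun r => !(headNe q r && headNe r p) ||
      decide (corner p q + corner q r + corner r p ≤ 3)) = true := by
  decide +kernel

theorem corner_add_le {p q r : List (Fin 2 × Bool)} (h₁ : HeadNe p q) (h₂ : HeadNe q r)
    (h₃ : HeadNe r p) : corner p q + corner q r + corner r p ≤ 3 := by
  have key : ∀ p q, HeadNe p q → trunc (p.take 3) ∈ truncWords ∧
      headNe (trunc (p.take 3)) (trunc (q.take 3)) = true ∧
      corner p q = corner (trunc (p.take 3)) (trunc (q.take 3)) := by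
    intro p q h
    have H := trunc_check
    rw [List.all_eq_true] at H
    have H1 := H _ (take_mem_shortWords p)
    simp only [Bool.and_eq_true, List.all_eq_true] at H1
    have H2 := H1.2 _ (take_mem_shortWords q)
    have h' := HeadNe.headNe_take h
    simp only [h', beq_true, Bool.not_true, Bool.false_or, beq_iff_eq] at H2
    refine ⟨by simpa using H1.1, H2.1, ?_⟩
    rw [← corner_take, H2.2]
  obtain ⟨m₁, e₁, k₁⟩ := key p q h₁
  obtain ⟨m₂, e₂, k₂⟩ := key q r h₂
  obtain ⟨m₃, e₃, k₃⟩ := key r p h₃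
  have H := corner_check
  simp only [List.all_eq_true] at H
  have H1 := H _ m₁ _ m₂
  simp only [e₁, Bool.not_true, Bool.false_or, List.all_eq_true] at H1
  have H2 := H1 _ m₃
  simp only [e₂, e₃, Bool.and_self, Bool.not_true, Bool.false_or, decide_eq_true_eq] at H2
  rw [k₁, k₂, k₃]
  exact H2

end F₂

/-! ### The quasimorphism, its defect and its values on powers of `w`. -/

namespace F₂

open FreeGroup

theorem HeadNe.of_isReduced {p q : List (Fin 2 × Bool)} (h : IsReduced (invRev p ++ q)) :
    HeadNe p q := by
  rcases p with _ | ⟨x, p⟩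
  · simp [HeadNe]
  rcases q with _ | ⟨y, q⟩
  · simp [HeadNe]
  rw [invRev_cons, List.append_assoc] at h
  have h' : IsReduced ([(x.1, !x.2), y] ++ q) := by
    have : FreeGroup.IsReduced (invRev [x] ++ y :: q) := List.IsChain.right_of_append h
    simpa [invRev] using this
  simp only [List.cons_append, List.nil_append, FreeGroup.isReduced_cons_cons] at h'
  simp only [HeadNe, List.head?_cons, Option.mem_some_iff, forall_eq']
  rintro rfl
  simpa using h'.1

/-- Here `z` is the cancelled part: `x`, `y`, `z` label the legs of the tripod read outward from its
centre. -/
theorem exists_tripod (L₁ L₂ : List (Fin 2 × Bool)) (h₁ : IsReduced L₁) (h₂ : IsReduced L₂) :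
    ∃ x y z, L₁ = invRev x ++ z ∧ L₂ = invRev z ++ y ∧ reduce (L₁ ++ L₂) = invRev x ++ y := by
  induction L₁ using List.reverseRecOn generalizing L₂ with
  | nil => exact ⟨[], L₂, [], by simp, by simp, by simpa using h₂.reduce_eq⟩
  | append_singleton L c ih =>
    by_cases hc : ∃ L', L₂ = (c.1, !c.2) :: L'
    · obtain ⟨L', rfl⟩ := hc
      obtain ⟨x, y, z, hx, hy, hr⟩ := ih L' (List.IsChain.left_of_append h₁)
        (List.IsChain.right_of_append (l₁ := [(c.1, !c.2)]) h₂)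
      refine ⟨x, y, z ++ [c], by simp [hx], by simp [hy, invRev], ?_⟩
      rw [← hr]
      apply reduce.Step.eq
      simpa using Red.Step.not (L₁ := L) (L₂ := L') (x := c.1) (b := c.2)
    · refine ⟨invRev (L ++ [c]), L₂, [], by simp, by simp, ?_⟩
      rw [invRev_invRev]
      apply IsReduced.reduce_eq
      rcases L₂ with _ | ⟨d, L'⟩
      · simpa using h₁
      have hd : IsReduced ([c] ++ d :: L') := by
        simp only [List.cons_append, List.nil_append, FreeGroup.isReduced_cons_cons]
        refine ⟨fun h => ?_, h₂⟩
        by_contra h'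
        refine hc ⟨L', ?_⟩
        congr 1
        ext
        · rw [h]
        · simp [Bool.eq_not_of_ne (Ne.symm h')]
      exact IsReduced.append_overlap h₁ hd (by simp)

/-- The antisymmetrized counting quasimorphism. -/
def quasi (g : F₂) : ℤ := weightedCount g.toWord - weightedCount g⁻¹.toWord

theorem quasi_inv (g : F₂) : quasi g⁻¹ = - quasi g := by
  simp only [quasi, inv_inv]; ring

theorem quasi_one : quasi 1 = 0 := by simp [quasi]

theorem quasi_mul_le (g h : F₂) : quasi (g * h) ≤ quasi g + quasi h + 3 := by
  obtain ⟨x, y, z, hx, hy, hr⟩ := exists_tripod g.toWord h.toWord isReduced_toWord isReduced_toWord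
  have hxy : IsReduced (invRev x ++ y) := by
    rw [← hr, ← toWord_mul]; exact isReduced_toWord
  have hxz : IsReduced (invRev x ++ z) := by rw [← hx]; exact isReduced_toWord
  have hzy : IsReduced (invRev z ++ y) := by rw [← hy]; exact isReduced_toWord
  have symm : ∀ {p q}, HeadNe p q → HeadNe q p := fun H c hc hc' => H c hc' hc
  -- The counts inside the legs cancel by antisymmetry, leaving exactly the sum of the three
  -- corners.
  have H := corner_add_le (HeadNe.of_isReduced hxy) (symm (HeadNe.of_isReduced hzy))
    (symm (HeadNe.of_isReduced hxz))
  simp only [quasi, toWord_inv, toWord_mul, hr]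
  simp only [hx, hy, invRev_append, invRev_invRev]
  simp only [corner, junction] at H
  linarith

theorem quasi_commutatorElement_mul_le (x y g : F₂) : quasi (⁅x, y⁆ * g) ≤ quasi g + 12 := by
  have h₁ := quasi_mul_le x (y * (x⁻¹ * (y⁻¹ * g)))
  have h₂ := quasi_mul_le y (x⁻¹ * (y⁻¹ * g))
  have h₃ := quasi_mul_le x⁻¹ (y⁻¹ * g)
  have h₄ := quasi_mul_le y⁻¹ g
  rw [quasi_inv] at h₃ h₄
  rw [commutatorElement_def, mul_assoc, mul_assoc, mul_assoc]
  linarith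

theorem quasi_prod_le (l : List F₂) (hl : ∀ x ∈ l, x ∈ commutatorSet F₂) :
    quasi l.prod ≤ 12 * l.length := by
  induction l with
  | nil => simp [quasi_one]
  | cons c l ih =>
    obtain ⟨x, y, rfl⟩ := hl c (by simp)
    have := quasi_commutatorElement_mul_le x y l.prod
    have := ih fun x hx => hl x (by simp [hx])
    simp only [List.prod_cons, List.length_cons]
    push_cast
    linarith

theorem weightedCount_append (l q : List (Fin 2 × Bool)) :
    weightedCount (l ++ q) = weightedCount l + weightedCount q + junction l q := by
  simp [junction]

theorem weightedCount_replicate (L : List (Fin 2 × Bool)) (hL : 3 ≤ L.length) (n : ℕ) :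
    weightedCount (List.replicate (n + 1) L).flatten =
      n * (weightedCount L + junction L L) + weightedCount L := by
  induction n with
  | zero => simp
  | succ n ih =>
    rw [List.replicate_succ, List.flatten_cons, weightedCount_append, ih,
      ← junction_take_right L (List.flatten _)]
    have : ((List.replicate (n + 1) L).flatten).take 3 = L.take 3 := by
      rw [List.replicate_succ, List.flatten_cons, List.take_append_of_le_length hL]
    rw [this, junction_take_right]
    push_cast
    ring

theorem toWord_w : w.toWord = [(0, true), (1, true), (0, true), (1, true), (0, false), (1, false),
    (0, true), (1, false), (0, false), (1, true), (0, false), (1, false)] := by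
  decide

theorem quasi_w_pow (n : ℕ) : quasi (w ^ (n + 1)) = 10 * n + quasi w := by
  have hw : IsCyclicallyReduced w.toWord := by
    rw [toWord_w]
    simp [isCyclicallyReduced_iff, FreeGroup.isReduced_cons_cons]
  have hw' : IsCyclicallyReduced w⁻¹.toWord := by
    rw [toWord_inv, toWord_w]
    simp [isCyclicallyReduced_iff, FreeGroup.isReduced_cons_cons, invRev]
  rw [quasi, quasi, ← inv_pow, toWord_pow, toWord_pow,
    (hw.flatten_replicate _).isReduced.reduce_eq, (hw'.flatten_replicate _).isReduced.reduce_eq,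
    weightedCount_replicate _ (by rw [toWord_w]; decide),
    weightedCount_replicate _ (by rw [toWord_inv, toWord_w]; decide)]
  have : (weightedCount w.toWord + junction w.toWord w.toWord) -
      (weightedCount w⁻¹.toWord + junction w⁻¹.toWord w⁻¹.toWord) = 10 := by
    rw [toWord_inv, toWord_w]; decide
  linear_combination (n : ℤ) * this

end F₂

/-! ### Commutator length of powers in an arbitrary group. -/

section CommutatorProducts

variable {G : Type*} [Group G]

/-- `g` is a product of at most `n` commutators. -/
def IsCommutatorProd (n : ℕ) (g : G) : Prop :=
  ∃ l : List G, (∀ x ∈ l, x ∈ commutatorSet G) ∧ l.prod = g ∧ l.length ≤ n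

namespace IsCommutatorProd

theorem one : IsCommutatorProd 0 (1 : G) := ⟨[], by simp⟩

theorem commutatorElement (x y : G) : IsCommutatorProd 1 ⁅x, y⁆ :=
  ⟨[⁅x, y⁆], by simp [commutator_mem_commutatorSet]⟩

theorem mul {m n : ℕ} {g h : G} (hg : IsCommutatorProd m g) (hh : IsCommutatorProd n h) :
    IsCommutatorProd (m + n) (g * h) := by
  obtain ⟨l, hl, rfl, hm⟩ := hg
  obtain ⟨k, hk, rfl, hn⟩ := hh
  refine ⟨l ++ k, ?_, by simp, by simp; omega⟩
  intro x hx
  rcases List.mem_append.1 hx with h | h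
  exacts [hl x h, hk x h]

theorem pow {m : ℕ} {g : G} (hg : IsCommutatorProd m g) (n : ℕ) :
    IsCommutatorProd (n * m) (g ^ n) := by
  induction n with
  | zero => simpa using one
  | succ n ih => rw [pow_succ, Nat.succ_mul]; exact ih.mul hg

theorem map {H : Type*} [Group H] (f : G →* H) {m : ℕ} {g : G} (hg : IsCommutatorProd m g) :
    IsCommutatorProd m (f g) := by
  obtain ⟨l, hl, rfl, hm⟩ := hg
  refine ⟨l.map f, ?_, (map_list_prod f l).symm, by simpa using hm⟩
  intro x hx
  obtain ⟨y, hy, rfl⟩ := List.mem_map.1 hx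
  obtain ⟨u, v, rfl⟩ := hl y hy
  exact ⟨f u, f v, (map_commutatorElement f u v).symm⟩

theorem conj {m : ℕ} {g : G} (hg : IsCommutatorProd m g) (c : G) :
    IsCommutatorProd m (c * g * c⁻¹) := by
  simpa using hg.map (MulAut.conj c).toMonoidHom

theorem inv {m : ℕ} {g : G} (hg : IsCommutatorProd m g) : IsCommutatorProd m g⁻¹ := by
  obtain ⟨l, hl, rfl, hm⟩ := hg
  refine ⟨(l.map (·⁻¹)).reverse, ?_, by rw [List.prod_inv_reverse], by simpa using hm⟩
  intro x hx
  rw [List.mem_reverse, List.mem_map] at hx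
  obtain ⟨y, hy, rfl⟩ := hx
  obtain ⟨u, v, rfl⟩ := hl y hy
  exact ⟨v, u, by rw [commutatorElement_inv]⟩

theorem of_isConj {m : ℕ} {g h : G} (hg : IsCommutatorProd m g) (hc : IsConj g h) :
    IsCommutatorProd m h := by
  obtain ⟨c, rfl⟩ := isConj_iff.1 hc
  exact hg.conj c

theorem exists_of_mem_commutator {g : G} (hg : g ∈ commutator G) :
    ∃ n, IsCommutatorProd n g := by
  rw [commutator_eq_closure] at hg
  induction hg using Subgroup.closure_induction with
  | mem x hx =>
    obtain ⟨u, v, rfl⟩ := hx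
    exact ⟨1, commutatorElement u v⟩
  | one => exact ⟨0, one⟩
  | mul x y _ _ hx hy =>
    obtain ⟨m, hm⟩ := hx
    obtain ⟨n, hn⟩ := hy
    exact ⟨_, hm.mul hn⟩
  | inv x _ hx =>
    obtain ⟨m, hm⟩ := hx
    exact ⟨m, hm.inv⟩

theorem mul_pow_mul_inv (x z : G) : ∀ n : ℕ,
    IsCommutatorProd (n / 2) ((x * z) ^ n * (x ^ n * z ^ n)⁻¹)
  | 0 => by simpa using one
  | 1 => by simpa using one
  | n + 2 => by
    have h₁ := (mul_pow_mul_inv x z n).conj ((x * z) ^ 2)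
    -- Raising the exponent by two leaves the factor (xz)²xⁿz⁻²x⁻ⁿx⁻², which is a conjugate of this
    -- single commutator.
    have h₂ := (commutatorElement (x ^ n * z⁻¹) (z⁻¹ * x⁻¹ * z⁻¹)).conj
      (x * z * x * z)
    have h₃ := h₁.mul h₂
    rw [Nat.add_div_right n two_pos]
    convert h₃ using 1
    have hc : ⁅x ^ n * z⁻¹, z⁻¹ * x⁻¹ * z⁻¹⁆ =
        x ^ n * z⁻¹ * z⁻¹ * (x ^ n)⁻¹ * x⁻¹ * z * x * z := by
      rw [commutatorElement_def]
      group
    rw [hc, add_comm n 2, pow_add (x * z), pow_add x, pow_add z, pow_two (x * z)]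
    generalize x ^ n = q
    generalize z ^ n = r
    generalize (x * z) ^ n = s
    group

/-- Write ⁅x, y⁆ as x · (yx⁻¹y⁻¹): separating the n-th powers costs n/2 commutators and leaves ⁅xⁿ,
y⁆. -/
theorem commutatorElement_pow (x y : G) (n : ℕ) : IsCommutatorProd (n / 2 + 1) (⁅x, y⁆ ^ n) := by
  have h := (mul_pow_mul_inv x (y * x⁻¹ * y⁻¹) n).mul (commutatorElement (x ^ n) y)
  convert h using 1
  rw [conj_pow, commutatorElement_def, commutatorElement_def]
  simp only [inv_pow]
  group

theorem mul_commutatorElement_pow {m : ℕ} {g : G} (hg : IsCommutatorProd m g) (x y : G) (n : ℕ) :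
    IsCommutatorProd (n * m + (n / 2 + 1)) ((g * ⁅x, y⁆) ^ n) := by
  -- The left side is a product of n conjugates of `g`.
  have key : ∀ c : G, IsCommutatorProd (n * m) ((g * c) ^ n * (c ^ n)⁻¹) := by
    intro c
    induction n with
    | zero => simpa using one
    | succ n ih =>
      have h := ih.mul (hg.conj (c ^ n))
      rw [Nat.succ_mul]
      convert h using 1
      rw [pow_succ (g * c), pow_succ c]
      generalize c ^ n = d
      group
  have h := (key ⁅x, y⁆).mul (commutatorElement_pow x y n)
  simpa using h

end IsCommutatorProd

end CommutatorProducts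

/-! ### The two bounds for powers of `w`, and the limit. -/

theorem commutatorLength_le {G : Type*} [Group G] {n : ℕ} {g : G} (h : IsCommutatorProd n g) :
    commutatorLength g ≤ n := by
  obtain ⟨l, hl, hp, hn⟩ := h
  exact (iInf₂_le l ⟨hl, hp⟩).trans (by exact_mod_cast hn)

namespace F₂

theorem isConj_inv_w_v : IsConj w⁻¹ v :=
  -- w⁻¹ = baBabA · baBABA, and `v` is the same word with its halves exchanged.
  isConj_iff.2 ⟨(b * a * B * a * b * A)⁻¹, by decide⟩

theorem prod_commutators_eq :
    ⁅a * b * a * B,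
      A * B * A * b * a * B * a * b * A * b * a * B * A * B * A * b * a * B * a * b * a * b *
        A * B * B⁆ *
    ⁅A * B * A * b * a, B * a * b * A * b * a * B * A * B * A * b * b * a⁆ *
    ⁅B * a * b * A * B * a * b * a * b * A, a * a * B * A * A * b⁆ =
      a * v ^ 3 * A := by
  simp only [v, commutatorElement_def, pow_three]
  group

theorem w_mem_commutator : w ∈ commutator F₂ := by
  rw [← Abelianization.ker_of, MonoidHom.mem_ker]
  simp only [w, map_mul, map_inv]
  generalize Abelianization.of a = x
  generalize Abelianization.of b = y
  have : ∀ {M : Type} [AddCommGroup M] (x y : M),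
      x + y + x + y + -x + -y + x + -y + -x + y + -x + -y = 0 := by
    intro M _ x y
    abel
  exact this (M := Additive (Abelianization F₂)) x y

theorem isCommutatorProd_w_pow_three_pow (k : ℕ) :
    IsCommutatorProd (k * 2 + (k / 2 + 1)) ((w ^ 3) ^ k) := by
  have h : IsCommutatorProd (k * 2 + (k / 2 + 1)) ((a * v ^ 3 * A) ^ k) := by
    rw [← prod_commutators_eq]
    exact ((IsCommutatorProd.commutatorElement _ _).mul
      (IsCommutatorProd.commutatorElement _ _)).mul_commutatorElement_pow _ _ k
  refine h.inv.of_isConj ?_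
  obtain ⟨c, hc⟩ := isConj_iff.1 isConj_inv_w_v
  have hv : a * v ^ 3 * A = a * c * (w ^ 3)⁻¹ * (a * c)⁻¹ := by
    rw [← hc, conj_pow]
    group
  refine isConj_iff.2 ⟨(a * c)⁻¹, ?_⟩
  rw [hv, conj_pow]
  generalize w ^ 3 = u
  group

theorem exists_isCommutatorProd_w_pow :
    ∃ C : ℕ, ∀ n : ℕ, ∃ m : ℕ, IsCommutatorProd m (w ^ n) ∧ 6 * m ≤ 5 * n + C := by
  obtain ⟨c, hc⟩ := IsCommutatorProd.exists_of_mem_commutator w_mem_commutator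
  -- `6` pays for the `+ 1` and `12 * c` for the at most two periods left over modulo three.
  refine ⟨6 + 12 * c, fun n =>
    ⟨n / 3 * 2 + (n / 3 / 2 + 1) + n % 3 * c, ?_, ?_⟩⟩
  · have := (isCommutatorProd_w_pow_three_pow (n / 3)).mul (hc.pow (n % 3))
    rwa [← pow_mul, ← pow_add, Nat.div_add_mod] at this
  · have h : n % 3 * c ≤ 2 * c := Nat.mul_le_mul_right c (by omega)
    omega

theorem le_commutatorLength_w_pow (n : ℕ) : ((5 * n / 6 : ℕ) : ℕ∞) ≤ commutatorLength (w ^ n) := by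
  refine le_iInf₂ fun l ⟨hl, h⟩ => ?_
  rcases n with _ | n
  · simp
  have h₁ := quasi_prod_le l hl
  have hw : 0 ≤ quasi w := by
    rw [quasi, FreeGroup.toWord_inv, toWord_w]; decide
  rw [h, quasi_w_pow] at h₁
  -- Nothing is lost from n + 1 to n: ⌊5(n+1)/6⌋ = ⌈5n/6⌉.
  have : 5 * (n + 1) / 6 ≤ l.length := by omega
  exact_mod_cast this

end F₂

open F₂ in
theorem tendsto_commutatorLength_w_pow_div :
    Tendsto (fun n : ℕ => (commutatorLength (w ^ n) : ℝ≥0∞) / (n : ℝ≥0∞)) atTop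
      (𝓝 (5 / 6)) := by
  obtain ⟨C, hC⟩ := exists_isCommutatorProd_w_pow
  have h56 : (5 / 6 : ℝ≥0∞) = ENNReal.ofReal (5 / 6) := by
    rw [ENNReal.ofReal_div_of_pos (by norm_num)]; norm_num
  have hlim : ∀ c : ℝ, Tendsto (fun n : ℕ => ENNReal.ofReal ((5 / 6 * n + c) / n)) atTop
      (𝓝 (5 / 6)) := by
    intro c
    rw [h56]
    apply ENNReal.tendsto_ofReal
    have h := (tendsto_const_nhds (x := (5 / 6 : ℝ))).add (tendsto_const_div_atTop_nhds_zero_nat c)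
    rw [add_zero] at h
    refine h.congr' ?_
    filter_upwards [eventually_gt_atTop 0] with n hn
    have : (n : ℝ) ≠ 0 := by positivity
    field_simp
  refine tendsto_of_tendsto_of_tendsto_of_le_of_le' (hlim (-(5 / 6))) (hlim (C / 6)) ?_ ?_
  · filter_upwards [eventually_gt_atTop 0] with n hn
    have hn' : (0 : ℝ) < n := by exact_mod_cast hn
    rw [ENNReal.ofReal_div_of_pos hn', ENNReal.ofReal_natCast]
    gcongr
    have h : 5 * n ≤ 6 * (5 * n / 6) + 5 := by omega
    have h' : 5 * (n : ℝ) ≤ 6 * (5 * n / 6 : ℕ) + 5 := by exact_mod_cast h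
    calc _ ≤ ENNReal.ofReal (5 * n / 6 : ℕ) := ENNReal.ofReal_le_ofReal (by linarith)
      _ = ((5 * n / 6 : ℕ) : ℝ≥0∞) := ENNReal.ofReal_natCast _
      _ = (((5 * n / 6 : ℕ) : ℕ∞) : ℝ≥0∞) := (ENat.toENNReal_coe _).symm
      _ ≤ commutatorLength (w ^ n) := ENat.toENNReal_mono (le_commutatorLength_w_pow n)
  · filter_upwards [eventually_gt_atTop 0] with n hn
    have hn' : (0 : ℝ) < n := by exact_mod_cast hn
    rw [ENNReal.ofReal_div_of_pos hn', ENNReal.ofReal_natCast]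
    gcongr
    obtain ⟨m, hm, hmC⟩ := hC n
    have hmC' : 6 * (m : ℝ) ≤ 5 * n + C := by exact_mod_cast hmC
    calc (commutatorLength (w ^ n) : ℝ≥0∞) ≤ ((m : ℕ∞) : ℝ≥0∞) :=
          ENat.toENNReal_mono (commutatorLength_le hm)
      _ = ENNReal.ofReal m := by simp
      _ ≤ _ := ENNReal.ofReal_le_ofReal (by linarith)

open F₂ in
theorem mainTheorem3 :
    w ∈ commutator F₂ ∧
    Tendsto (fun n : ℕ => (commutatorLength (w ^ n) : ℝ≥0∞) / (n : ℝ≥0∞)) atTop (𝓝 (5 / 6)) ∧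
    scl w = 5 / 6 ∧
    (∀ k : ℤ, (scl w).toReal ≠ (k : ℝ) / 2) ∧
    (¬ ∀ g ∈ commutator F₂, ∃ k : ℤ, (scl g).toReal = (k : ℝ) / 2) ∧
    IsConj w⁻¹ v ∧
    ⁅a * b * a * B,
      A * B * A * b * a * B * a * b * A * b * a * B * A * B * A * b * a * B * a * b * a * b *
        A * B * B⁆ *
    ⁅A * B * A * b * a, B * a * b * A * b * a * B * A * B * A * b * b * a⁆ *
    ⁅B * a * b * A * B * a * b * a * b * A, a * a * B * A * A * b⁆ =
      a * v ^ 3 * A := by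
  have hlim := tendsto_commutatorLength_w_pow_div
  have hscl : scl w = 5 / 6 := hlim.liminf_eq
  have hne : ∀ k : ℤ, (scl w).toReal ≠ (k : ℝ) / 2 := by
    intro k hk
    rw [hscl, ENNReal.toReal_div, ENNReal.toReal_ofNat, ENNReal.toReal_ofNat] at hk
    have h : (5 : ℝ) = 3 * k := by linarith
    have h' : (5 : ℤ) = 3 * k := by exact_mod_cast h
    omega
  refine ⟨w_mem_commutator, hlim, hscl, hne, fun h => ?_, isConj_inv_w_v, prod_commutators_eq⟩
  obtain ⟨k, hk⟩ := h w w_mem_commutator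
  exact hne k hk
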